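/- Let $D=\mathbb{C}[x_1,\dots,x_n]\langle\partial_1,\dots,\partial_n\rangle$ be the Weyl algebra with the filtration $F_d(D)$ $(d\in\mathbb{Z})$ by the order of differential operators, that is, $F_d(D)$ is the span of the $x^\alpha\partial^\beta$ with $|\beta|\le d$. An $F$-filtration of a left $D$-module $M$ is an increasing exhaustive filtration $(F_d(M))_{d\in\mathbb{Z}}$ by subgroups with $F_e(D)F_d(M)\subset F_{d+e}(M)$. For $\mathbf{n}\in\mathbb{Z}^r$ let $D^r[\mathbf{n}]$ be $D^r$ with $F_d(D^r[\mathbf{n}])=\bigoplus_i F_{d-n_i}(D)$. A filtration of $M$ is good if $M$ is isomorphic, as a filtered module, to some $D^r[\mathbf{n}]/N$ with the quotient filtration. A filtered free resolution of a filtered module $M$ is a finite complex of $D$-modules $$0\to D^{r_\delta}[\mathbf{n}^{(\delta)}]\to\cdots\to D^{r_0}[\mathbf{n}^{(0)}]\to M\to 0$$ whose restriction to $F_d$ is exact for every $d$. Its $K$-polynomial is $$K_F(M;T)=\sum_i(-1)^i\sum_j T^{n^{(i)}_j}\in\mathbb{Z}[T,T^{-1}],$$ and the multidegree $\mathcal{C}_F(M;T)$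 is the nonzero term of least degree in $T$ of $K_F(M;1-T)\in\mathbb{Z}[[T]]$ (and $0$ if $K_F(M;T)=0$). Then: (1) For every $F$-filtered $D$-module $M$, any two filtered free resolutions of $M$ have the same $K$-polynomial; that is, $K_F(M;T)$ does not depend on the filtered free resolution. (2) For every $D$-module $M$ there are $m,d\in\mathbb{N}$ such that, for every good filtration of $M$ and every filtered free resolution of $M$ with that filtration, $\mathcal{C}_F(M;T)=mT^d$; that is, the multidegree is a monomial $mT^d$ with $m\in\mathbb{N}$, independent of the good filtration. -/

import Mathlib

noncomputable section

/-- The algebra of operators on `ℂ[x₁,…,xₙ]` generated by the multiplications by the `xᵢ` and the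
partial derivatives `∂ᵢ`. -/
def weylSubalgebra (n : ℕ) : Subalgebra ℂ (Module.End ℂ (MvPolynomial (Fin n) ℂ)) :=
  Algebra.adjoin ℂ
    (Set.range (fun i : Fin n =>
        LinearMap.mulLeft ℂ (MvPolynomial.X i : MvPolynomial (Fin n) ℂ)) ∪
      Set.range (fun i : Fin n =>
        ((MvPolynomial.pderiv i : Derivation ℂ (MvPolynomial (Fin n) ℂ) (MvPolynomial (Fin n) ℂ)) :
          MvPolynomial (Fin n) ℂ →ₗ[ℂ] MvPolynomial (Fin n) ℂ)))

/-- The Weyl algebra `D = ℂ[x₁,…,xₙ]⟨∂₁,…,∂ₙ⟩`, realized as the algebra of differential operators on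
`ℂ[x₁,…,xₙ]`. -/
def WeylAlgebra (n : ℕ) : Type := weylSubalgebra n

namespace WeylAlgebra

instance (n : ℕ) : Ring (WeylAlgebra n) := inferInstanceAs (Ring (weylSubalgebra n))

instance (n : ℕ) : Algebra ℂ (WeylAlgebra n) := inferInstanceAs (Algebra ℂ (weylSubalgebra n))

/-- The element `xᵢ` of the Weyl algebra. -/
def x {n : ℕ} (i : Fin n) : WeylAlgebra n :=
  ⟨LinearMap.mulLeft ℂ (MvPolynomial.X i : MvPolynomial (Fin n) ℂ),
    Algebra.subset_adjoin (Or.inl ⟨i, rfl⟩)⟩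

/-- The element `∂ᵢ` of the Weyl algebra. -/
def partialD {n : ℕ} (i : Fin n) : WeylAlgebra n :=
  ⟨((MvPolynomial.pderiv i : Derivation ℂ (MvPolynomial (Fin n) ℂ) (MvPolynomial (Fin n) ℂ)) :
      MvPolynomial (Fin n) ℂ →ₗ[ℂ] MvPolynomial (Fin n) ℂ),
    Algebra.subset_adjoin (Or.inr ⟨i, rfl⟩)⟩

/-- The normally ordered monomial `x₁^α₁ ⋯ xₙ^αₙ ∂₁^β₁ ⋯ ∂ₙ^βₙ`. -/
def normalMonomial {n : ℕ} (α β : Fin n → ℕ) : WeylAlgebra n :=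
  (List.ofFn fun i => x i ^ α i).prod * (List.ofFn fun i => partialD i ^ β i).prod

/-- The `F`-filtration of the Weyl algebra, by the order of differential operators: `F_d(D)`
consists of the `ℂ`-linear combinations of the monomials `x^α ∂^β` with `|β| ≤ d`. -/
def orderFiltration (n : ℕ) (d : ℤ) : Submodule ℂ (WeylAlgebra n) :=
  Submodule.span ℂ
    {P | ∃ α β : Fin n → ℕ, ((∑ i, β i : ℕ) : ℤ) ≤ d ∧ P = normalMonomial α β}

/-- The filtration of the shifted free module `D^r[s]`: `F_d(D^r[s]) = ⨁ᵢ F_{d - sᵢ}(D)`. -/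
def freeFiltration {n r : ℕ} (s : Fin r → ℤ) (d : ℤ) : AddSubgroup (Fin r → WeylAlgebra n) :=
  AddSubgroup.pi Set.univ fun i => (orderFiltration n (d - s i)).toAddSubgroup

end WeylAlgebra

open WeylAlgebra in
/-- An `F`-filtration of a left `D`-module `M`: an increasing exhaustive filtration compatible with
the `F`-filtration of `D`. It is indexed by `ℤ`; a filtration indexed by `ℕ` is one with
`F_d(M) = 0` for `d < 0`. -/
structure FFiltration (n : ℕ) (M : Type*) [AddCommGroup M] [Module (WeylAlgebra n) M] where
  /-- The subgroup `F_d(M)`. -/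
  level : ℤ → AddSubgroup M
  mono : Monotone level
  exhaustive : ∀ m : M, ∃ d : ℤ, m ∈ level d
  smul_mem : ∀ (e d : ℤ) (P : WeylAlgebra n) (m : M),
    P ∈ orderFiltration n e → m ∈ level d → P • m ∈ level (e + d)

namespace FFiltration

variable {n : ℕ} {M : Type*} [AddCommGroup M] [Module (WeylAlgebra n) M]

/-- The filtration is good: `M` is isomorphic, as a filtered module, to some `D^r[s] / N` with the
quotient filtration. -/
def IsGood (F : FFiltration n M) : Prop :=
  ∃ (r : ℕ) (s : Fin r → ℤ) (N : Submodule (WeylAlgebra n) (Fin r → WeylAlgebra n))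
    (e : ((Fin r → WeylAlgebra n) ⧸ N) ≃ₗ[WeylAlgebra n] M),
    ∀ d : ℤ, F.level d =
      ((WeylAlgebra.freeFiltration s d).map N.mkQ.toAddMonoidHom).map e.toLinearMap.toAddMonoidHom

end FFiltration

/-- A filtered free resolution
`0 → D^{r_δ}[s^(δ)] → ⋯ → D^{r_1}[s^(1)] → D^{r_0}[s^(0)] → M → 0`
of a filtered `D`-module: finite, with finite ranks, and exact in every filtration level `F_d`.
The sequence is continued by zero modules beyond position `δ`. -/
structure FilteredFreeResolution {n : ℕ} {M : Type*} [AddCommGroup M] [Module (WeylAlgebra n) M]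
    (F : FFiltration n M) where
  /-- The length `δ`. -/
  length : ℕ
  /-- The ranks `r_i`. -/
  rank : ℕ → ℕ
  rank_eq_zero : ∀ i, length < i → rank i = 0
  /-- The shifts `s^(i)`. -/
  shift : ∀ i, Fin (rank i) → ℤ
  /-- The differentials. -/
  diff : ∀ i, (Fin (rank (i + 1)) → WeylAlgebra n) →ₗ[WeylAlgebra n] (Fin (rank i) → WeylAlgebra n)
  /-- The augmentation. -/
  aug : (Fin (rank 0) → WeylAlgebra n) →ₗ[WeylAlgebra n] M
  map_aug : ∀ d : ℤ,
    (WeylAlgebra.freeFiltration (shift 0) d).map aug.toAddMonoidHom = F.level d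
  exact_zero : ∀ d : ℤ,
    (WeylAlgebra.freeFiltration (shift 1) d).map (diff 0).toAddMonoidHom =
      aug.toAddMonoidHom.ker ⊓ WeylAlgebra.freeFiltration (shift 0) d
  exact_succ : ∀ (i : ℕ) (d : ℤ),
    (WeylAlgebra.freeFiltration (shift (i + 2)) d).map (diff (i + 1)).toAddMonoidHom =
      (diff i).toAddMonoidHom.ker ⊓ WeylAlgebra.freeFiltration (shift (i + 1)) d

/-- `1 - T` as a unit of `ℤ⟦T⟧`. -/
def oneSubT : (PowerSeries ℤ)ˣ where
  val := 1 - PowerSeries.X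
  inv := PowerSeries.mk 1
  val_inv := by rw [mul_comm]; exact PowerSeries.mk_one_mul_one_sub_eq_one ℤ
  inv_val := PowerSeries.mk_one_mul_one_sub_eq_one ℤ

/-- The substitution `K(T) ↦ K(1 - T)`, from `ℤ[T, T⁻¹]` to `ℤ⟦T⟧`. -/
def substOneSubT : LaurentPolynomial ℤ →+* PowerSeries ℤ :=
  LaurentPolynomial.eval₂ (Int.castRingHom (PowerSeries ℤ)) oneSubT

/-- The nonzero term of least degree of a power series (and `0` for the zero series). -/
def leastTerm (f : PowerSeries ℤ) : Polynomial ℤ :=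
  Polynomial.monomial f.order.toNat (PowerSeries.coeff f.order.toNat f)

namespace FilteredFreeResolution

variable {n : ℕ} {M : Type*} [AddCommGroup M] [Module (WeylAlgebra n) M] {F : FFiltration n M}

/-- The `K`-polynomial `∑ᵢ (-1)^i ∑ⱼ T^{s^(i)_j}` computed from a filtered free resolution. -/
def kPolynomial (ρ : FilteredFreeResolution F) : LaurentPolynomial ℤ :=
  ∑ i ∈ Finset.range (ρ.length + 1), (-1) ^ i * ∑ j, LaurentPolynomial.T (ρ.shift i j)

/-- The multidegree: the term of least degree in `K(1 - T)`. -/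
def multidegree (ρ : FilteredFreeResolution F) : Polynomial ℤ :=
  leastTerm (substOneSubT ρ.kPolynomial)

end FilteredFreeResolution

end

/-! The polynomial ring `ℂ[x]` lies in order `0` of `D`, so every `F_d(M)` is a `ℂ[x]`-module, and
`F_d(D)` is free over `ℂ[x]` on the `∂^β` with `|β| ≤ d`, of rank `(n+d).choose n` for `d ≥ 0`. Rank
over the domain `ℂ[x]` is additive, so exactness of a filtered free resolution in level `d`
expresses the rank of `F_d(M)` as the alternating sum of the ranks of the free terms, which is
`hilbertValue n d` of the `K`-polynomial (`finrank_levelSubmodule`). A Laurent polynomial can be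
recovered from these values (`eq_zero_of_hilbertValue_eq_zero`), and the ranks do not depend on the
resolution; this is (1).

For (2), write `K = T^(-N) (1-T)^c Q` with `Q(1) ≠ 0`. The multidegree is then `Q(1) T^c`. The
Hilbert function has generating series `K / (1-T)^(n+1)`, so for `c ≤ n` it grows like `Q(1) d^(n-c)
/ (n-c)!`; a nonzero monotone nonnegative one cannot have `c > n`. Two filtrations of `M` admitting
resolutions contain each other up to a shift (`exists_level_le`), and a shift does not affect the
leading growth. Hence `c` and `Q(1)` agree, and `Q(1) > 0` because ranks are nonnegative. -/

open Filter Topology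

/-! ### Hilbert functions of Laurent polynomials -/

/-- The number of exponents `β ∈ ℕⁿ` with `|β| ≤ e`. -/
def exponentCount (n : ℕ) (e : ℤ) : ℕ := if 0 ≤ e then (n + e.toNat).choose n else 0

/-- The value at `d` of the Hilbert function with `K`-polynomial `K`: the additive map with
`T^s ↦ exponentCount n (d - s)`. -/
noncomputable def hilbertValue (n : ℕ) (d : ℤ) : LaurentPolynomial ℤ →+ ℤ :=
  (Finsupp.liftAddHom fun s : ℤ => AddMonoidHom.mulRight (exponentCount n (d - s) : ℤ)).comp
    (AddMonoidAlgebra.coeffAddEquiv (R := ℤ) (M := ℤ)).toAddMonoidHom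

theorem hilbertValue_apply (n : ℕ) (d : ℤ) (K : LaurentPolynomial ℤ) :
    hilbertValue n d K = ∑ s ∈ K.coeff.support, K.coeff s * exponentCount n (d - s) := rfl

theorem hilbertValue_C_mul_T (n : ℕ) (d s a : ℤ) :
    hilbertValue n d (LaurentPolynomial.C a * LaurentPolynomial.T s) =
      a * exponentCount n (d - s) := by
  rw [← LaurentPolynomial.single_eq_C_mul_T]
  exact Finsupp.liftAddHom_apply_single
    (fun s : ℤ => AddMonoidHom.mulRight (exponentCount n (d - s) : ℤ)) s a

theorem hilbertValue_T (n : ℕ) (d s : ℤ) :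
    hilbertValue n d (LaurentPolynomial.T s) = exponentCount n (d - s) := by
  simpa using hilbertValue_C_mul_T n d s 1

theorem hilbertValue_mul_T (n : ℕ) (d t : ℤ) (K : LaurentPolynomial ℤ) :
    hilbertValue n (d + t) (K * LaurentPolynomial.T t) = hilbertValue n d K := by
  induction K using LaurentPolynomial.induction_on' with
  | add p q hp hq => rw [add_mul, map_add, map_add, hp, hq]
  | C_mul_T s a =>
    rw [mul_assoc, ← LaurentPolynomial.T_add, hilbertValue_C_mul_T, hilbertValue_C_mul_T]
    congr 3
    ring

/-- A Laurent polynomial is determined by its Hilbert function. -/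
theorem eq_zero_of_hilbertValue_eq_zero (n : ℕ) {K : LaurentPolynomial ℤ}
    (h : ∀ d, hilbertValue n d K = 0) : K = 0 := by
  by_contra hK
  have hne : K.coeff.support.Nonempty := by
    rw [Finsupp.support_nonempty_iff]
    intro h0
    exact hK (by ext a; simp [h0])
  -- At `d = s`, the least exponent of `K`, every other term has a negative argument and vanishes,
  -- while `exponentCount n 0 = 1`.
  set s := K.coeff.support.min' hne
  have hs : s ∈ K.coeff.support := Finset.min'_mem _ _
  have h1 := h s
  rw [hilbertValue_apply, Finset.sum_eq_single s] at h1
  · simp [exponentCount] at h1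
    exact Finsupp.mem_support_iff.1 hs h1
  · intro t ht hts
    have : s ≤ t := Finset.min'_le _ _ ht
    have hlt : ¬ 0 ≤ s - t := by omega
    rw [exponentCount, if_neg hlt, Nat.cast_zero, mul_zero]
  · exact fun h => absurd hs h

/-- The binomials `(n+d).choose n` are the coefficients of `1/(1-T)^(n+1)`, and multiplying by `T^k`
shifts them by `k`. -/
theorem hilbertValue_toLaurent (n d : ℕ) (P : Polynomial ℤ) :
    hilbertValue n d (Polynomial.toLaurent P) =
      PowerSeries.coeff d
        ((P : PowerSeries ℤ) * (PowerSeries.invOneSubPow ℤ (n + 1) : PowerSeries ℤ)) := by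
  induction P using Polynomial.induction_on' with
  | add p q hp hq => rw [map_add, map_add, hp, hq, Polynomial.coe_add, add_mul, map_add]
  | monomial k a =>
    rw [← Polynomial.C_mul_X_pow_eq_monomial, Polynomial.toLaurent_C_mul_X_pow,
      hilbertValue_C_mul_T, PowerSeries.invOneSubPow_val_succ_eq_mk_add_choose]
    simp only [Polynomial.coe_mul, Polynomial.coe_C, Polynomial.coe_pow, Polynomial.coe_X,
      mul_assoc, PowerSeries.coeff_C_mul, PowerSeries.coeff_X_pow_mul', PowerSeries.coeff_mk,
      exponentCount]
    by_cases hk : k ≤ d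
    · have : (0 : ℤ) ≤ d - k := by omega
      have h2 : ((d : ℤ) - k).toNat = d - k := by omega
      simp [hk, h2]
    · have : ¬ (0 : ℤ) ≤ d - k := by omega
      simp [hk]

/-! ### The least term of `K(1 - T)` -/

/-- The factorization `K = T^(-N) (1 - T)^c Q(T)` with `Q(1) ≠ 0`. -/
theorem exists_factorization_at_one {K : LaurentPolynomial ℤ} (hK : K ≠ 0) :
    ∃ (N c : ℕ) (Q : Polynomial ℤ), Q.eval 1 ≠ 0 ∧
      K * LaurentPolynomial.T N = Polynomial.toLaurent ((1 - Polynomial.X) ^ c * Q) := by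
  obtain ⟨N, P, hP⟩ := LaurentPolynomial.exists_T_pow K
  have hP0 : P ≠ 0 := by
    rintro rfl
    rw [map_zero] at hP
    have := congrArg (· * LaurentPolynomial.T (-N : ℤ)) hP
    simp only [zero_mul, mul_assoc, ← LaurentPolynomial.T_add] at this
    simp at this
    exact hK this.symm
  obtain ⟨c, q, hq, hnd⟩ : ∃ (c : ℕ) (q : Polynomial ℤ),
      P = (Polynomial.X - Polynomial.C 1) ^ c * q ∧ ¬ (Polynomial.X - Polynomial.C 1) ∣ q :=
    ⟨_, Polynomial.exists_eq_pow_rootMultiplicity_mul_and_not_dvd P hP0 1⟩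
  -- The sign converts the root factor `(X - 1)^c` into `(1 - X)^c`.
  refine ⟨N, c, (-1) ^ c * q, ?_, ?_⟩
  · rw [Polynomial.dvd_iff_isRoot, Polynomial.IsRoot.def] at hnd
    simpa [Polynomial.eval_mul, Polynomial.eval_pow] using hnd
  · rw [← hP, ← mul_assoc, ← mul_pow, mul_neg_one, neg_sub, ← map_one Polynomial.C, hq]

theorem leastTerm_X_pow_mul (c : ℕ) (u : PowerSeries ℤ)
    (hu : PowerSeries.constantCoeff u ≠ 0) :
    leastTerm (PowerSeries.X ^ c * u) =
      Polynomial.monomial c (PowerSeries.constantCoeff u) := by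
  have h : PowerSeries.order (PowerSeries.X ^ c * u) = c := by
    rw [PowerSeries.order_eq_nat]
    constructor
    · rw [PowerSeries.coeff_X_pow_mul']
      simpa using hu
    · intro i hi
      rw [PowerSeries.coeff_X_pow_mul', if_neg (by omega)]
  rw [leastTerm, h, ENat.toNat_natCast, PowerSeries.coeff_X_pow_mul']
  simp

/-- The substitution sends `1 - T` to `X` and `T` to a unit with constant coefficient `1`. So `K`
becomes `X^c` times a series with constant coefficient `Q(1)`. -/
theorem leastTerm_substOneSubT {K : LaurentPolynomial ℤ} {N c : ℕ} {Q : Polynomial ℤ}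
    (hQ : Q.eval 1 ≠ 0)
    (hK : K * LaurentPolynomial.T N = Polynomial.toLaurent ((1 - Polynomial.X) ^ c * Q)) :
    leastTerm (substOneSubT K) = Polynomial.monomial c (Q.eval 1) := by
  have h := congrArg substOneSubT hK
  rw [map_mul] at h
  simp only [substOneSubT, LaurentPolynomial.eval₂_toLaurent, LaurentPolynomial.eval₂_T,
    Polynomial.eval₂_mul, Polynomial.eval₂_pow, Polynomial.eval₂_sub, Polynomial.eval₂_one,
    Polynomial.eval₂_X] at h
  rw [← Units.eq_mul_inv_iff_mul_eq] at h
  set v : PowerSeries ℤ := Polynomial.eval₂ (Int.castRingHom (PowerSeries ℤ)) oneSubT.val Q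
  have hT : (1 : PowerSeries ℤ) - (oneSubT : PowerSeries ℤ) = PowerSeries.X := by
    simp [oneSubT]
  rw [hT, mul_assoc] at h
  have hcu : PowerSeries.constantCoeff (oneSubT : PowerSeries ℤ) = 1 := by simp [oneSubT]
  have hci : PowerSeries.constantCoeff ((oneSubT⁻¹ : (PowerSeries ℤ)ˣ) : PowerSeries ℤ) = 1 := by
    have := congrArg PowerSeries.constantCoeff (oneSubT.mul_inv)
    rwa [map_mul, hcu, one_mul, map_one] at this
  have hcv : PowerSeries.constantCoeff v = Q.eval 1 := by
    rw [Polynomial.hom_eval₂, hcu, Polynomial.eval]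
    congr 1
    exact RingHom.ext_int _ _
  have hu : PowerSeries.constantCoeff
      (v * ((oneSubT ^ (N : ℤ))⁻¹ : (PowerSeries ℤ)ˣ).val) = Q.eval 1 := by
    rw [map_mul, hcv, zpow_natCast, ← inv_pow, Units.val_pow_eq_pow_val, map_pow, hci, one_pow,
      mul_one]
  have := leastTerm_X_pow_mul c _ (by rw [hu]; exact hQ)
  rw [hu, ← h] at this
  exact this

/-! ### Growth of Hilbert functions -/

theorem coeff_hilbertPoly_succ (k : ℕ) (q : Polynomial ℝ) :
    (Polynomial.hilbertPoly q (k + 1)).coeff k = q.eval 1 / k.factorial := by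
  rw [Polynomial.hilbertPoly_succ, Polynomial.finsetSum_coeff]
  simp only [Polynomial.coeff_smul, Polynomial.coeff_preHilbertPoly_self, smul_eq_mul]
  rw [← Finset.sum_mul, Polynomial.eval_eq_sum, Polynomial.sum_def]
  simp [div_eq_mul_inv]

theorem natDegree_hilbertPoly_succ_le (k : ℕ) (q : Polynomial ℝ) :
    (Polynomial.hilbertPoly q (k + 1)).natDegree ≤ k := by
  rw [Polynomial.hilbertPoly_succ]
  refine Polynomial.natDegree_sum_le_of_forall_le _ _ fun i _ => ?_
  exact (Polynomial.natDegree_smul_le _ _).trans (Polynomial.natDegree_preHilbertPoly ℝ k i).le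

theorem Polynomial.tendsto_eval_div_pow {p : Polynomial ℝ} {k : ℕ} (hp : p.natDegree ≤ k) :
    Tendsto (fun x : ℝ => p.eval x / x ^ k) atTop (𝓝 (p.coeff k)) := by
  rcases hp.lt_or_eq with h | h
  · rw [Polynomial.coeff_eq_zero_of_natDegree_lt h]
    have := Polynomial.div_tendsto_atTop_zero_of_degree_lt p (Polynomial.X ^ k)
      (by rw [Polynomial.degree_X_pow]; exact Polynomial.degree_le_natDegree.trans_lt (by exact_mod_cast h))
    simpa using this
  · by_cases h0 : p = 0
    · subst h0; simp
    have := Polynomial.div_tendsto_atTop_leadingCoeff_div_of_degree_eq p (Polynomial.X ^ k)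
      (by rw [Polynomial.degree_X_pow, Polynomial.degree_eq_natDegree h0, h])
    simpa [Polynomial.leadingCoeff, h] using this

/-- For `d` above the degree of `Q`, the coefficient is the value at `d` of a Hilbert polynomial of
degree at most `k`, whose coefficient in degree `k` is `Q(1)/k!`. -/
theorem tendsto_coeff_mul_invOneSubPow (k : ℕ) (Q : Polynomial ℤ) :
    Tendsto (fun d : ℕ => ((PowerSeries.coeff d ((Q : PowerSeries ℤ) *
      (PowerSeries.invOneSubPow ℤ (k + 1) : PowerSeries ℤ)) : ℤ) : ℝ) / (d : ℝ) ^ k) atTop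
      (𝓝 ((Q.eval 1 : ℤ) / k.factorial : ℝ)) := by
  set q : Polynomial ℝ := Q.map (Int.castRingHom ℝ)
  have h1 := (Polynomial.tendsto_eval_div_pow (natDegree_hilbertPoly_succ_le k q)).comp
    tendsto_natCast_atTop_atTop
  have hq : q.eval 1 = (Q.eval 1 : ℤ) := by simp [q]
  rw [coeff_hilbertPoly_succ, hq] at h1
  refine h1.congr' ?_
  filter_upwards [eventually_gt_atTop q.natDegree] with d hd
  simp only [Function.comp]
  rw [← Polynomial.coeff_mul_invOneSubPow_eq_hilbertPoly_eval (k + 1) hd]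
  congr 1
  have hmap : PowerSeries.map (Int.castRingHom ℝ) (PowerSeries.invOneSubPow ℤ (k + 1)).val =
      (PowerSeries.invOneSubPow ℝ (k + 1)).val := by
    ext m
    simp [PowerSeries.invOneSubPow_val_succ_eq_mk_add_choose]
  rw [← eq_intCast (Int.castRingHom ℝ), ← PowerSeries.coeff_map, ← hmap,
    Polynomial.polynomial_map_coe, ← map_mul]

theorem tendsto_div_pow_shift {f : ℕ → ℝ} {k : ℕ} {a : ℝ}
    (h : Tendsto (fun d : ℕ => f d / (d : ℝ) ^ k) atTop (𝓝 a)) (N : ℕ) :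
    Tendsto (fun d : ℕ => f (d + N) / (d : ℝ) ^ k) atTop (𝓝 a) := by
  have h1 := h.comp (tendsto_add_atTop_nat N)
  have h2 : Tendsto (fun d : ℕ => (((d + N : ℕ) : ℝ) / d) ^ k) atTop (𝓝 1) := by
    have h3 : Tendsto (fun d : ℕ => 1 + (N : ℝ) / d) atTop (𝓝 (1 + 0)) :=
      tendsto_const_nhds.add (tendsto_const_div_atTop_nhds_zero_nat _)
    rw [add_zero] at h3
    have h4 := h3.pow k
    rw [one_pow] at h4
    refine h4.congr' ?_
    filter_upwards [eventually_gt_atTop 0] with d hd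
    have : (d : ℝ) ≠ 0 := by positivity
    push_cast
    field_simp
  have h5 := h1.mul h2
  rw [mul_one] at h5
  refine h5.congr' ?_
  filter_upwards [eventually_gt_atTop 0] with d hd
  have : (d : ℝ) ≠ 0 := by positivity
  have : ((d + N : ℕ) : ℝ) ≠ 0 := by positivity
  simp only [Function.comp]
  rw [div_pow]
  field_simp

/-- If `f(d) ≤ g(d + N)`, then the growth of `f` is at most that of `g`. -/
theorem growth_le {f g : ℕ → ℝ} {k l N : ℕ} {a b : ℝ}
    (hf : Tendsto (fun d : ℕ => f d / (d : ℝ) ^ k) atTop (𝓝 a))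
    (hg : Tendsto (fun d : ℕ => g d / (d : ℝ) ^ l) atTop (𝓝 b))
    (hfg : ∀ d, f d ≤ g (d + N)) (ha : 0 < a) : k ≤ l ∧ (k = l → a ≤ b) := by
  have hg' := tendsto_div_pow_shift hg N
  constructor
  · by_contra! hlt
    -- If `k > l`, the bound by `g` forces `f d / d^k` to be at most a convergent sequence times
    -- `d^(-(e+1))`, so its limit would be at most `0`.
    obtain ⟨e, rfl⟩ : ∃ e, k = l + (e + 1) := ⟨k - l - 1, by omega⟩
    have h0 : Tendsto (fun d : ℕ => (((d : ℝ) ^ (e + 1))⁻¹)) atTop (𝓝 0) :=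
      ((tendsto_pow_atTop (by omega)).comp tendsto_natCast_atTop_atTop).inv_tendsto_atTop
    have h1 := hg'.mul h0
    rw [mul_zero] at h1
    refine absurd (le_of_tendsto_of_tendsto' hf h1 fun d => ?_) (not_le.2 ha)
    rw [pow_add, ← div_div, div_eq_mul_inv (_ / _)]
    gcongr
    exact hfg d
  · rintro rfl
    refine le_of_tendsto_of_tendsto' hf hg' fun d => ?_
    gcongr
    exact hfg d

/-- The asymptotics of the Hilbert function are read off from the least term of `K(1 - T)`. -/
theorem leastTerm_and_hilbertValue_asymptotics (n : ℕ) {K : LaurentPolynomial ℤ} (hK : K ≠ 0) :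
    ∃ (c : ℕ) (q : ℤ), q ≠ 0 ∧ leastTerm (substOneSubT K) = Polynomial.monomial c q ∧
      ((c ≤ n ∧ Tendsto (fun d : ℕ => (hilbertValue n d K : ℝ) / (d : ℝ) ^ (n - c)) atTop
        (𝓝 (q / (n - c).factorial))) ∨ ∀ᶠ d : ℕ in atTop, hilbertValue n d K = 0) := by
  obtain ⟨N, c, Q, hQ, hfac⟩ := exists_factorization_at_one hK
  refine ⟨c, Q.eval 1, hQ, leastTerm_substOneSubT hQ hfac, ?_⟩
  have hval (d : ℕ) : hilbertValue n d K = PowerSeries.coeff (d + N)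
      ((Q : PowerSeries ℤ) * ((1 - PowerSeries.X) ^ c *
        (PowerSeries.invOneSubPow ℤ (n + 1) : PowerSeries ℤ))) := by
    rw [← hilbertValue_mul_T n d N, hfac, ← Nat.cast_add, hilbertValue_toLaurent]
    congr 1
    simp
    ring
  -- For `c ≤ n`, the series is `Q / (1-T)^(n-c+1)`. For `c > n`, the denominator cancels entirely,
  -- leaving a polynomial whose coefficients vanish eventually.
  by_cases hc : c ≤ n
  · refine Or.inl ⟨hc, ?_⟩
    have h1 := tendsto_div_pow_shift (tendsto_coeff_mul_invOneSubPow (n - c) Q) N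
    refine h1.congr fun d => ?_
    rw [hval, ← PowerSeries.one_sub_pow_mul_invOneSubPow_val_add_eq_invOneSubPow_val ℤ
      (n - c + 1) c, show n - c + 1 + c = n + 1 by omega]
  · right
    obtain ⟨e, rfl⟩ : ∃ e, c = e + (n + 1) := ⟨c - (n + 1), by omega⟩
    filter_upwards [eventually_gt_atTop (Q * (1 - Polynomial.X) ^ e).natDegree] with d hd
    rw [hval, PowerSeries.one_sub_pow_add_mul_invOneSubPow_val_eq_one_sub_pow]
    have : (Q : PowerSeries ℤ) * (1 - PowerSeries.X) ^ e =
        ((Q * (1 - Polynomial.X) ^ e : Polynomial ℤ) : PowerSeries ℤ) := by simp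
    rw [this, Polynomial.coeff_coe]
    exact Polynomial.coeff_eq_zero_of_natDegree_lt (by omega)

/-- Two nonzero monotone nonnegative Hilbert functions that bound each other up to a shift have
`K`-polynomials with the same least term in `1 - T`, and this term is a monomial with a
nonnegative coefficient. -/
theorem leastTerm_eq_of_hilbertValue_le {n : ℕ} {K : LaurentPolynomial ℤ}
    (hpos : ∀ d, 0 ≤ hilbertValue n d K) (hmono : Monotone fun d => hilbertValue n d K) :
    ∃ m c : ℕ, ∀ (K' : LaurentPolynomial ℤ), (∀ d, 0 ≤ hilbertValue n d K') →
      (Monotone fun d => hilbertValue n d K') →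
      (∃ N : ℕ, ∀ d, hilbertValue n d K ≤ hilbertValue n (d + N) K') →
      (∃ N : ℕ, ∀ d, hilbertValue n d K' ≤ hilbertValue n (d + N) K) →
      leastTerm (substOneSubT K') = Polynomial.C (m : ℤ) * Polynomial.X ^ c := by
  -- A monotone nonnegative function that is eventually zero is zero everywhere; this excludes the
  -- case `c > n`.
  have eventually_ne : ∀ {L : LaurentPolynomial ℤ}, (∀ d, 0 ≤ hilbertValue n d L) →
      (Monotone fun d => hilbertValue n d L) → L ≠ 0 →
      ¬ ∀ᶠ d : ℕ in atTop, hilbertValue n d L = 0 := by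
    intro L hp hm hL h
    refine hL (eq_zero_of_hilbertValue_eq_zero n fun d => le_antisymm ?_ (hp d))
    obtain ⟨e, he, hde⟩ := (h.and (eventually_ge_atTop d.toNat)).exists
    rw [← he]
    exact hm (by omega)
  by_cases hK : K = 0
  · refine ⟨0, 0, fun K' hp _ _ ⟨N, hN⟩ => ?_⟩
    have : K' = 0 := eq_zero_of_hilbertValue_eq_zero n fun d =>
      le_antisymm ((hN d).trans_eq (by rw [hK, map_zero])) (hp d)
    simp [this, leastTerm]
  have key : ∀ {L : LaurentPolynomial ℤ}, (∀ d, 0 ≤ hilbertValue n d L) →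
      (Monotone fun d => hilbertValue n d L) → L ≠ 0 → ∃ (c : ℕ) (q : ℤ), 0 < q ∧ c ≤ n ∧
        leastTerm (substOneSubT L) = Polynomial.monomial c q ∧
        Tendsto (fun d : ℕ => (hilbertValue n d L : ℝ) / (d : ℝ) ^ (n - c)) atTop
          (𝓝 (q / (n - c).factorial)) := by
    intro L hp hm hL
    obtain ⟨c, q, hq, hl, h | h⟩ := leastTerm_and_hilbertValue_asymptotics n hL
    · refine ⟨c, q, lt_of_le_of_ne ?_ hq.symm, h.1, hl, h.2⟩
      have h0 : (0 : ℝ) ≤ q / (n - c).factorial := by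
        refine ge_of_tendsto' h.2 fun d => ?_
        have : (0 : ℝ) ≤ hilbertValue n d L := by exact_mod_cast hp d
        positivity
      have hf : (0 : ℝ) < (n - c).factorial := by positivity
      have := mul_nonneg h0 hf.le
      rw [div_mul_cancel₀ _ hf.ne'] at this
      exact_mod_cast this
    · exact absurd h (eventually_ne hp hm hL)
  obtain ⟨c, q, hq, hc, -, ht⟩ := key hpos hmono hK
  refine ⟨q.toNat, c, fun K' hp hm ⟨N, hN⟩ ⟨N', hN'⟩ => ?_⟩
  have hK' : K' ≠ 0 := by
    rintro rfl
    exact hK (eq_zero_of_hilbertValue_eq_zero n fun d =>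
      le_antisymm ((hN d).trans_eq (map_zero _)) (hpos d))
  obtain ⟨c', q', hq', hc', hl, ht'⟩ := key hp hm hK'
  have pos (a : ℤ) (h : 0 < a) (k : ℕ) : (0 : ℝ) < a / k.factorial := by
    have : (0 : ℝ) < a := by exact_mod_cast h
    positivity
  have h1 := growth_le ht ht' (N := N) (fun d => by
    rw [Nat.cast_add]; exact_mod_cast hN d) (pos q hq _)
  have h2 := growth_le ht' ht (N := N') (fun d => by
    rw [Nat.cast_add]; exact_mod_cast hN' d) (pos q' hq' _)
  -- The two growth comparisons give `n - c = n - c'`; the bounds `c, c' ≤ n` make the truncated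
  -- subtraction injective here.
  have hcc : c = c' := by omega
  subst hcc
  have hqq := le_antisymm (h1.2 rfl) (h2.2 rfl)
  rw [div_left_inj' (by positivity)] at hqq
  have hqq' : q = q' := by exact_mod_cast hqq
  rw [hl, ← hqq', Int.toNat_of_nonneg hq.le, Polynomial.C_mul_X_pow_eq_monomial]

/-! ### The Weyl algebra as a free module over the polynomials -/

open MvPolynomial in
theorem mulLeft_mem_weylSubalgebra {n : ℕ} (p : MvPolynomial (Fin n) ℂ) :
    Algebra.lmul ℂ (MvPolynomial (Fin n) ℂ) p ∈ weylSubalgebra n := by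
  induction p using MvPolynomial.induction_on with
  | C a =>
    have : Algebra.lmul ℂ (MvPolynomial (Fin n) ℂ) (C a) =
        algebraMap ℂ (Module.End ℂ (MvPolynomial (Fin n) ℂ)) a := by
      ext1 q
      simp
    rw [this]
    exact Subalgebra.algebraMap_mem _ _
  | add p q hp hq => rw [map_add]; exact Subalgebra.add_mem _ hp hq
  | mul_X p i hp =>
    rw [map_mul]
    exact Subalgebra.mul_mem _ hp (WeylAlgebra.x i).2

namespace WeylAlgebra

/-- The inclusion of the polynomials in the Weyl algebra. -/
noncomputable def ofPoly (n : ℕ) : MvPolynomial (Fin n) ℂ →ₐ[ℂ] WeylAlgebra n :=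
  (Algebra.lmul ℂ (MvPolynomial (Fin n) ℂ)).codRestrict (weylSubalgebra n)
    mulLeft_mem_weylSubalgebra

/-- The action of an element of the Weyl algebra on polynomials. -/
noncomputable def toEnd (n : ℕ) :
    WeylAlgebra n →ₐ[ℂ] Module.End ℂ (MvPolynomial (Fin n) ℂ) :=
  (weylSubalgebra n).val

theorem toEnd_ofPoly {n : ℕ} (p q : MvPolynomial (Fin n) ℂ) : toEnd n (ofPoly n p) q = p * q := rfl

theorem toEnd_partialD {n : ℕ} (i : Fin n) (q : MvPolynomial (Fin n) ℂ) :
    toEnd n (partialD i) q = MvPolynomial.pderiv i q := rfl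

theorem ofPoly_X {n : ℕ} (i : Fin n) : ofPoly n (MvPolynomial.X i) = x i := rfl

noncomputable instance (n : ℕ) : Module (MvPolynomial (Fin n) ℂ) (WeylAlgebra n) :=
  Module.compHom _ (ofPoly n).toRingHom

theorem poly_smul_def {n : ℕ} (p : MvPolynomial (Fin n) ℂ) (P : WeylAlgebra n) :
    p • P = ofPoly n p * P := rfl

instance (n : ℕ) : IsScalarTower ℂ (MvPolynomial (Fin n) ℂ) (WeylAlgebra n) where
  smul_assoc a p P := by simp [poly_smul_def]

instance (n : ℕ) : IsScalarTower (MvPolynomial (Fin n) ℂ) (WeylAlgebra n) (WeylAlgebra n) where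
  smul_assoc p P Q := by simp [poly_smul_def, mul_assoc]

/-- The monomial `∂₁^β₁ ⋯ ∂ₙ^βₙ`. -/
noncomputable def partialMonomial {n : ℕ} (β : Fin n → ℕ) : WeylAlgebra n :=
  (List.ofFn fun i => partialD i ^ β i).prod

theorem toEnd_partialD_pow {n : ℕ} (i : Fin n) (k : ℕ) (s : Fin n →₀ ℕ) (a : ℂ) :
    toEnd n (partialD i ^ k) (MvPolynomial.monomial s a) =
      MvPolynomial.monomial (s - Finsupp.single i k) (a * (s i).descFactorial k) := by
  induction k with
  | zero => simp
  | succ k ih =>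
    rw [pow_succ', map_mul, Module.End.mul_apply, ih, toEnd_partialD, MvPolynomial.pderiv_monomial,
      tsub_tsub, ← Finsupp.single_add, Nat.descFactorial_succ]
    congr 1
    simp
    ring

theorem toEnd_list_prod {n : ℕ} (β : Fin n → ℕ) (s : Fin n →₀ ℕ) (l : List (Fin n))
    (hl : l.Nodup) :
    toEnd n (l.map fun i => partialD i ^ β i).prod (MvPolynomial.monomial s 1) =
      MvPolynomial.monomial (s - (l.map fun i => Finsupp.single i (β i)).sum)
        (l.map fun i => ((s i).descFactorial (β i) : ℂ)).prod := by
  induction l with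
  | nil => simp
  | cons i l ih =>
    have hi : i ∉ l := (List.nodup_cons.1 hl).1
    -- The derivatives in `l` leave the exponent of `x_i` untouched, so `∂_i` still meets the full
    -- exponent `s i`.
    have h0 : (l.map fun i => Finsupp.single i (β i)).sum i = 0 := by
      clear ih hl
      induction l with
      | nil => simp
      | cons j l ih =>
        simp only [List.mem_cons, not_or] at hi
        simp [ih hi.2, Ne.symm hi.1]
    rw [List.map_cons, List.prod_cons, map_mul, Module.End.mul_apply,
      ih (List.nodup_cons.1 hl).2, toEnd_partialD_pow, tsub_tsub, Finsupp.tsub_apply, h0]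
    simp only [List.map_cons, List.sum_cons, List.prod_cons, tsub_zero]
    rw [add_comm, mul_comm]

theorem toEnd_partialMonomial {n : ℕ} (β : Fin n → ℕ) (s : Fin n →₀ ℕ) :
    toEnd n (partialMonomial β) (MvPolynomial.monomial s 1) =
      MvPolynomial.monomial (s - ∑ i, Finsupp.single i (β i))
        (∏ i, ((s i).descFactorial (β i) : ℂ)) := by
  rw [partialMonomial, List.ofFn_eq_map, toEnd_list_prod β s _ (List.nodup_finRange n),
    Fin.sum_univ_def, Fin.prod_univ_def]

/-- Some `β i` must exceed `γ i`, and then `∂_i^(β i)` kills `x^γ`. -/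
theorem toEnd_partialMonomial_eq_zero {n : ℕ} {β γ : Fin n → ℕ} (h : ∑ i, γ i ≤ ∑ i, β i)
    (hne : β ≠ γ) :
    toEnd n (partialMonomial β)
      (MvPolynomial.monomial (Finsupp.equivFunOnFinite.symm γ) 1) = 0 := by
  rw [toEnd_partialMonomial]
  obtain ⟨i, hi⟩ : ∃ i, γ i < β i := by
    by_contra! hle
    refine hne (funext fun i => ?_)
    exact (Finset.sum_eq_sum_iff_of_le fun i _ => hle i).1
      (le_antisymm (Finset.sum_le_sum fun i _ => hle i) h) i (Finset.mem_univ i)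
  rw [Finset.prod_eq_zero (Finset.mem_univ i), map_zero]
  simpa using Nat.descFactorial_eq_zero_iff_lt.2 hi

theorem toEnd_partialMonomial_self {n : ℕ} (γ : Fin n → ℕ) :
    toEnd n (partialMonomial γ)
      (MvPolynomial.monomial (Finsupp.equivFunOnFinite.symm γ) 1) =
      MvPolynomial.C (∏ i, ((γ i).factorial : ℂ)) := by
  rw [toEnd_partialMonomial, MvPolynomial.C_apply]
  congr 2
  · rw [tsub_eq_zero_iff_le]
    intro i
    simp [Finsupp.finsetSum_apply, Finsupp.single_apply]
  · simp [Nat.descFactorial_self]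

/-- Apply a relation `∑ p_β ∂^β = 0` to `x^γ`, where `γ` has least total degree among the exponents
with `p_γ ≠ 0`. Only the term of `γ` survives, giving `p_γ γ! = 0`. -/
theorem linearIndependent_partialMonomial (n : ℕ) :
    LinearIndependent (MvPolynomial (Fin n) ℂ)
      (partialMonomial : (Fin n → ℕ) → WeylAlgebra n) := by
  rw [linearIndependent_iff']
  intro t p hp
  by_contra! hne
  obtain ⟨γ, hγ, hmin⟩ := (t.filter fun β => p β ≠ 0).exists_min_image (fun β => ∑ i, β i)
    (by obtain ⟨β, hβ, h⟩ := hne; exact ⟨β, Finset.mem_filter.2 ⟨hβ, h⟩⟩)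
  rw [Finset.mem_filter] at hγ
  have h := congrArg (fun P => toEnd n P
    (MvPolynomial.monomial (Finsupp.equivFunOnFinite.symm γ) 1)) hp
  simp only [map_sum, poly_smul_def, map_mul, LinearMap.sum_apply, Module.End.mul_apply,
    toEnd_ofPoly, map_zero, LinearMap.zero_apply] at h
  rw [Finset.sum_eq_single γ, toEnd_partialMonomial_self] at h
  · rcases mul_eq_zero.1 h with h | h
    · exact hγ.2 h
    · rw [MvPolynomial.C_eq_zero, Finset.prod_eq_zero_iff] at h
      obtain ⟨i, -, hi⟩ := h
      exact Nat.factorial_ne_zero _ (Nat.cast_eq_zero.1 hi)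
  · intro β hβ hne
    by_cases h0 : p β = 0
    · rw [h0, zero_mul]
    · rw [toEnd_partialMonomial_eq_zero (hmin β (Finset.mem_filter.2 ⟨hβ, h0⟩)) hne, mul_zero]
  · exact fun h => absurd hγ.1 h

/-- The exponents `β` with `|β| ≤ d`. -/
def boundedExponents (n : ℕ) (d : ℤ) : Set (Fin n → ℕ) := {β | ((∑ i, β i : ℕ) : ℤ) ≤ d}

/-- The order filtration, as a filtration by modules over the polynomials. -/
noncomputable def orderSubmodule (n : ℕ) (d : ℤ) :
    Submodule (MvPolynomial (Fin n) ℂ) (WeylAlgebra n) :=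
  Submodule.span _ (Set.range fun β : boundedExponents n d => partialMonomial β.1)

theorem ofPoly_monomial {n : ℕ} (α : Fin n → ℕ) :
    ofPoly n (MvPolynomial.monomial (Finsupp.equivFunOnFinite.symm α) 1) =
      (List.ofFn fun i => x i ^ α i).prod := by
  rw [MvPolynomial.monomial_eq, Finsupp.prod_fintype _ _ (by simp), Fin.prod_univ_def, map_one,
    one_mul, map_list_prod, List.ofFn_eq_map, List.map_map]
  congr 2
  ext1 i
  rw [Function.comp_apply, map_pow, ofPoly_X]
  rfl

theorem normalMonomial_eq_smul {n : ℕ} (α β : Fin n → ℕ) :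
    normalMonomial α β =
      (MvPolynomial.monomial (Finsupp.equivFunOnFinite.symm α) 1 : MvPolynomial (Fin n) ℂ) •
        partialMonomial β := by
  rw [poly_smul_def, ofPoly_monomial]; rfl

/-- In normal order the `x`'s stand on the left, so left multiplication by a polynomial preserves
the `ℂ`-span of the `x^α ∂^β` with `|β| ≤ d`. -/
theorem mem_orderSubmodule {n : ℕ} {d : ℤ} {P : WeylAlgebra n} :
    P ∈ orderSubmodule n d ↔ P ∈ orderFiltration n d := by
  constructor
  · intro h
    induction h using Submodule.span_induction with
    | mem P h =>
      obtain ⟨⟨β, hβ⟩, rfl⟩ := h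
      refine Submodule.subset_span ⟨0, β, hβ, ?_⟩
      simp [normalMonomial, partialMonomial]
    | zero => exact zero_mem _
    | add P Q _ _ hP hQ => exact add_mem hP hQ
    | smul p P _ hP =>
      clear * - hP
      induction hP using Submodule.span_induction with
      | mem P h =>
        obtain ⟨α, β, hβ, rfl⟩ := h
        induction p using MvPolynomial.induction_on' with
        | add p q hp hq => rw [add_smul]; exact add_mem hp hq
        | monomial s a =>
          have : MvPolynomial.monomial s a = a • MvPolynomial.monomial s (1 : ℂ) := by
            rw [MvPolynomial.smul_monomial, smul_eq_mul, mul_one]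
          rw [this, smul_assoc]
          refine Submodule.smul_mem _ _ (Submodule.subset_span ⟨s + α, β, hβ, ?_⟩)
          rw [normalMonomial_eq_smul, normalMonomial_eq_smul, smul_smul,
            MvPolynomial.monomial_mul, one_mul]
          congr 3
          ext i
          simp
      | zero => rw [smul_zero]; exact zero_mem _
      | add P Q _ _ hP hQ => rw [smul_add]; exact add_mem hP hQ
      | smul a P _ hP =>
        rw [poly_smul_def, mul_smul_comm]
        exact Submodule.smul_mem _ _ hP
  · intro h
    induction h using Submodule.span_induction with
    | mem P h =>
      obtain ⟨α, β, hβ, rfl⟩ := h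
      rw [normalMonomial_eq_smul]
      exact Submodule.smul_mem _ _ (Submodule.subset_span ⟨⟨β, hβ⟩, rfl⟩)
    | zero => exact zero_mem _
    | add P Q _ _ hP hQ => exact add_mem hP hQ
    | smul a P _ hP =>
      have : a • P = (algebraMap ℂ (MvPolynomial (Fin n) ℂ) a) • P := (algebraMap_smul _ a P).symm
      rw [this]
      exact Submodule.smul_mem _ _ hP

/-! ### Ranks of the filtration levels of free modules -/

/-- Adding a slack variable turns the exponents of degree at most `e` into those of degree `e` in
one more variable. -/
noncomputable def boundedExponentsEquivSym (n e : ℕ) :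
    boundedExponents n e ≃ Sym (Fin (n + 1)) e :=
  { toFun := fun β => ⟨Fin.cons (e - ∑ i, β.1 i) β.1, by
      have h : ∑ i, β.1 i ≤ e := by exact Nat.cast_le.1 (show ((∑ i, β.1 i : ℕ) : ℤ) ≤ e from β.2)
      rw [Fin.sum_univ_succ]
      simp only [Fin.cons_zero, Fin.cons_succ]
      omega⟩
    invFun := fun γ => ⟨Fin.tail γ.1, by
      have h := γ.2
      rw [Fin.sum_univ_succ] at h
      simp only [boundedExponents, Set.mem_ofPred_eq, Fin.tail]
      omega⟩
    left_inv := fun β => by simp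
    right_inv := fun γ => by
      have h := γ.2
      rw [Fin.sum_univ_succ] at h
      ext i
      refine Fin.cases ?_ (fun j => ?_) i
      · simp only [Fin.cons_zero, Fin.tail]
        omega
      · simp [Fin.tail] :
    boundedExponents n e ≃ {γ : Fin (n + 1) → ℕ // ∑ i, γ i = e} }.trans
    (Sym.equivNatSumOfFintype (Fin (n + 1)) e).symm

theorem boundedExponents_eq_empty {n : ℕ} {d : ℤ} (hd : ¬ 0 ≤ d) : boundedExponents n d = ∅ := by
  ext β
  simp only [boundedExponents, Set.mem_ofPred_eq, Set.mem_empty_iff_false, iff_false]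
  omega

instance (n : ℕ) (d : ℤ) : Finite (boundedExponents n d) := by
  by_cases hd : 0 ≤ d
  · lift d to ℕ using hd
    exact Finite.of_equiv _ (boundedExponentsEquivSym n d).symm
  · rw [boundedExponents_eq_empty hd]
    infer_instance

theorem card_boundedExponents (n : ℕ) (d : ℤ) :
    Nat.card (boundedExponents n d) = exponentCount n d := by
  by_cases hd : 0 ≤ d
  · lift d to ℕ using hd
    rw [Nat.card_congr (boundedExponentsEquivSym n d), Nat.card_eq_fintype_card,
      Sym.card_sym_eq_choose, Fintype.card_fin, exponentCount, if_pos (by omega), Int.toNat_natCast,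
      show n + 1 + d - 1 = n + d by omega, Nat.choose_symm_add]
  · rw [boundedExponents_eq_empty hd, exponentCount, if_neg hd]
    simp

theorem linearIndependent_boundedExponents (n : ℕ) (d : ℤ) :
    LinearIndependent (MvPolynomial (Fin n) ℂ)
      (fun β : boundedExponents n d => (partialMonomial β.1 : WeylAlgebra n)) :=
  (linearIndependent_partialMonomial n).comp _ Subtype.val_injective

instance (n : ℕ) (d : ℤ) : Module.Finite (MvPolynomial (Fin n) ℂ) (orderSubmodule n d) :=
  Module.Finite.of_basis (Module.Basis.span (linearIndependent_boundedExponents n d))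

instance (n : ℕ) (d : ℤ) : Module.Free (MvPolynomial (Fin n) ℂ) (orderSubmodule n d) :=
  Module.Free.of_basis (Module.Basis.span (linearIndependent_boundedExponents n d))

theorem finrank_orderSubmodule (n : ℕ) (d : ℤ) :
    Module.finrank (MvPolynomial (Fin n) ℂ) (orderSubmodule n d) = exponentCount n d := by
  exact (Module.finrank_eq_nat_card_basis
    (Module.Basis.span (linearIndependent_boundedExponents n d))).trans (card_boundedExponents n d)

/-- The filtration of `D^r[s]`, as a filtration by modules over the polynomials. -/
noncomputable def freeSubmodule {n r : ℕ} (s : Fin r → ℤ) (d : ℤ) :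
    Submodule (MvPolynomial (Fin n) ℂ) (Fin r → WeylAlgebra n) :=
  Submodule.pi Set.univ fun i => orderSubmodule n (d - s i)

theorem mem_freeSubmodule {n r : ℕ} {s : Fin r → ℤ} {d : ℤ} {v : Fin r → WeylAlgebra n} :
    v ∈ freeSubmodule s d ↔ v ∈ freeFiltration s d := by
  simp only [freeSubmodule, freeFiltration, Submodule.mem_pi, AddSubgroup.mem_pi,
    mem_orderSubmodule, Submodule.mem_toAddSubgroup]

/-- `F_d(D^r[s])` is the product of the `F_{d - sᵢ}(D)`. -/
noncomputable def freeSubmoduleEquiv {n r : ℕ} (s : Fin r → ℤ) (d : ℤ) :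
    freeSubmodule (n := n) s d ≃ₗ[MvPolynomial (Fin n) ℂ] ∀ i, orderSubmodule n (d - s i) where
  toFun v i := ⟨v.1 i, Submodule.mem_pi.1 v.2 i (Set.mem_univ i)⟩
  invFun w := ⟨fun i => (w i).1, Submodule.mem_pi.2 fun i _ => (w i).2⟩
  map_add' _ _ := rfl
  map_smul' _ _ := rfl
  left_inv _ := rfl
  right_inv _ := rfl

instance {n r : ℕ} (s : Fin r → ℤ) (d : ℤ) :
    Module.Finite (MvPolynomial (Fin n) ℂ) (freeSubmodule (n := n) s d) :=
  Module.Finite.equiv (freeSubmoduleEquiv s d).symm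

theorem finrank_freeSubmodule {n r : ℕ} (s : Fin r → ℤ) (d : ℤ) :
    Module.finrank (MvPolynomial (Fin n) ℂ) (freeSubmodule (n := n) s d) =
      ∑ i, exponentCount n (d - s i) := by
  rw [(freeSubmoduleEquiv s d).finrank_eq, Module.finrank_pi_fintype]
  simp only [finrank_orderSubmodule]

/-- This is what makes each level of an `F`-filtration a module over the polynomials. -/
theorem ofPoly_mem_orderFiltration {n : ℕ} (p : MvPolynomial (Fin n) ℂ) :
    ofPoly n p ∈ orderFiltration n 0 := by
  have h : (p • partialMonomial 0 : WeylAlgebra n) ∈ orderSubmodule n 0 :=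
    Submodule.smul_mem _ _ (Submodule.subset_span ⟨⟨0, by simp [boundedExponents]⟩, rfl⟩)
  rw [mem_orderSubmodule] at h
  simpa [poly_smul_def, partialMonomial] using h

end WeylAlgebra

/-! ### Additivity of rank along exact sequences -/

/-- Rank-nullity for `f` restricted to `L`. The shape `ker f ⊓ L` matches the exactness conditions
of a filtered free resolution. -/
theorem Submodule.finrank_map_add_finrank_ker_inf {R : Type*} [CommRing R] [IsDomain R]
    {V W : Type*} [AddCommGroup V] [Module R V] [AddCommGroup W] [Module R W]
    (L : Submodule R V) [Module.Finite R L] (f : V →ₗ[R] W) :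
    Module.finrank R (L.map f) + Module.finrank R (LinearMap.ker f ⊓ L : Submodule R V) =
      Module.finrank R L := by
  have h := (LinearMap.ker (f.domRestrict L)).finrank_quotient_add_finrank
  rw [LinearEquiv.finrank_eq (f.domRestrict L).quotKerEquivRange, LinearMap.range_domRestrict,
    LinearMap.ker_domRestrict] at h
  rw [← h, inf_comm, ← Submodule.map_comap_subtype,
    LinearEquiv.finrank_eq (Submodule.equivSubtypeMap L (Submodule.comap L.subtype _))]

/-- The alternating sum attached to a finite exact sequence. -/
theorem eq_alternating_sum {a b : ℕ → ℤ} {l : ℕ} (hab : ∀ i, b i + b (i + 1) = a i)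
    (hb : b (l + 1) = 0) : b 0 = ∑ i ∈ Finset.range (l + 1), (-1) ^ i * a i := by
  have h (k : ℕ) : b 0 = ∑ i ∈ Finset.range k, (-1) ^ i * a i + (-1) ^ k * b k := by
    induction k with
    | zero => simp
    | succ k ih =>
      rw [ih, Finset.sum_range_succ, ← hab k]
      ring
  rw [h (l + 1), hb, mul_zero, add_zero]

/-! ### Hilbert functions of filtered free resolutions -/

open WeylAlgebra

section

variable {n : ℕ} {M : Type*} [AddCommGroup M] [Module (WeylAlgebra n) M] {F : FFiltration n M}

namespace FilteredFreeResolution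

theorem map_diff_succ_freeSubmodule (ρ : FilteredFreeResolution F) (i : ℕ) (d : ℤ) :
    (freeSubmodule (ρ.shift (i + 2)) d).map
        ((ρ.diff (i + 1)).restrictScalars (MvPolynomial (Fin n) ℂ)) =
      LinearMap.ker ((ρ.diff i).restrictScalars (MvPolynomial (Fin n) ℂ)) ⊓
        freeSubmodule (ρ.shift (i + 1)) d := by
  ext v
  have h := SetLike.ext_iff.1 (ρ.exact_succ i d) v
  simpa [mem_freeSubmodule] using h

theorem hilbertValue_kPolynomial (ρ : FilteredFreeResolution F) (d : ℤ) :
    hilbertValue n d ρ.kPolynomial =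
      ∑ i ∈ Finset.range (ρ.length + 1), (-1) ^ i *
        ((∑ j, exponentCount n (d - ρ.shift i j) : ℕ) : ℤ) := by
  rw [kPolynomial, map_sum]
  refine Finset.sum_congr rfl fun i _ => ?_
  have h : ((-1) ^ i * ∑ j, LaurentPolynomial.T (ρ.shift i j) : LaurentPolynomial ℤ) =
      ((-1) ^ i : ℤ) • ∑ j, LaurentPolynomial.T (ρ.shift i j) := by
    rw [zsmul_eq_mul]
    push_cast
    rfl
  rw [h, map_zsmul, map_sum, smul_eq_mul]
  simp only [hilbertValue_T]
  push_cast
  rfl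

/-- A filtration with a filtered free resolution is contained, up to a shift, in any other one. -/
theorem exists_level_le (ρ : FilteredFreeResolution F) (F' : FFiltration n M) :
    ∃ N : ℕ, ∀ d, F.level d ≤ F'.level (d + N) := by
  choose e he using fun j => F'.exhaustive (ρ.aug (Pi.single j 1))
  -- The `j`-th generator has degree `ρ.shift 0 j` in the resolution and its image lies in level `e
  -- j` of `F'`. A sum of nonnegative parts bounds all the discrepancies at once.
  refine ⟨∑ j, (e j - ρ.shift 0 j).toNat, fun d m hm => ?_⟩
  rw [← ρ.map_aug d] at hm
  obtain ⟨v, hv, rfl⟩ := hm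
  have hsum : ρ.aug v = ∑ j, v j • ρ.aug (Pi.single j 1) := by
    conv_lhs => rw [← Finset.univ_sum_single v, map_sum]
    refine Finset.sum_congr rfl fun j _ => ?_
    rw [← map_smul, ← Pi.single_smul', smul_eq_mul, mul_one]
  show ρ.aug v ∈ _
  rw [hsum]
  refine sum_mem fun j _ => ?_
  have hvj := (AddSubgroup.mem_pi _).1 hv j (Set.mem_univ j)
  refine F'.mono ?_ (F'.smul_mem _ _ _ _ hvj (he j))
  have h1 : (e j - ρ.shift 0 j).toNat ≤ ∑ j, (e j - ρ.shift 0 j).toNat :=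
    Finset.single_le_sum (f := fun j => (e j - ρ.shift 0 j).toNat) (fun _ _ => Nat.zero_le _)
      (Finset.mem_univ j)
  omega

end FilteredFreeResolution

end

section

variable {n : ℕ} {M : Type*} [AddCommGroup M] [Module (WeylAlgebra n) M]
  [Module (MvPolynomial (Fin n) ℂ) M] [IsScalarTower (MvPolynomial (Fin n) ℂ) (WeylAlgebra n) M]

namespace FFiltration

/-- `F_d(M)` as a module over the polynomials. -/
def levelSubmodule (F : FFiltration n M) (d : ℤ) : Submodule (MvPolynomial (Fin n) ℂ) M where
  toAddSubmonoid := (F.level d).toAddSubmonoid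
  smul_mem' p m hm := by
    have h := F.smul_mem 0 d (ofPoly n p) m (ofPoly_mem_orderFiltration p) hm
    have h1 : ofPoly n p = p • (1 : WeylAlgebra n) := by rw [poly_smul_def, mul_one]
    rw [h1, smul_assoc, one_smul, zero_add] at h
    exact h

theorem mem_levelSubmodule {F : FFiltration n M} {d : ℤ} {m : M} :
    m ∈ F.levelSubmodule d ↔ m ∈ F.level d := Iff.rfl

end FFiltration

namespace FilteredFreeResolution

variable {F : FFiltration n M}

theorem map_aug_freeSubmodule (ρ : FilteredFreeResolution F) (d : ℤ) :
    (freeSubmodule (ρ.shift 0) d).map (ρ.aug.restrictScalars (MvPolynomial (Fin n) ℂ)) =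
      F.levelSubmodule d := by
  ext m
  rw [FFiltration.mem_levelSubmodule, ← ρ.map_aug d]
  simp [mem_freeSubmodule]

theorem map_diff_zero_freeSubmodule (ρ : FilteredFreeResolution F) (d : ℤ) :
    (freeSubmodule (ρ.shift 1) d).map ((ρ.diff 0).restrictScalars (MvPolynomial (Fin n) ℂ)) =
      LinearMap.ker (ρ.aug.restrictScalars (MvPolynomial (Fin n) ℂ)) ⊓
        freeSubmodule (ρ.shift 0) d := by
  ext v
  have h := SetLike.ext_iff.1 (ρ.exact_zero d) v
  simpa [mem_freeSubmodule] using h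

theorem finite_levelSubmodule (ρ : FilteredFreeResolution F) (d : ℤ) :
    Module.Finite (MvPolynomial (Fin n) ℂ) (F.levelSubmodule d) := by
  rw [← ρ.map_aug_freeSubmodule d]
  infer_instance

/-- The `K`-polynomial computes the ranks of the `F_d(M)` over the polynomials. -/
theorem finrank_levelSubmodule (ρ : FilteredFreeResolution F) (d : ℤ) :
    (Module.finrank (MvPolynomial (Fin n) ℂ) (F.levelSubmodule d) : ℤ) =
      hilbertValue n d ρ.kPolynomial := by
  rw [hilbertValue_kPolynomial]
  -- `b 0` is the rank of `F_d(M)` and `b (i + 1)` the rank of the image of `diff i` in level `d`.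
  -- By exactness that image is the kernel at position `i`, so `b i + b (i + 1)` is the rank of the
  -- `i`-th free term.
  let b : ℕ → ℤ := fun i => Nat.rec
    (Module.finrank (MvPolynomial (Fin n) ℂ) (F.levelSubmodule d) : ℤ)
    (fun i _ => (Module.finrank (MvPolynomial (Fin n) ℂ) ((freeSubmodule (ρ.shift (i + 1)) d).map
      ((ρ.diff i).restrictScalars (MvPolynomial (Fin n) ℂ))) : ℤ)) i
  refine eq_alternating_sum (b := b) (fun i => ?_) ?_
  · rw [← finrank_freeSubmodule (n := n)]
    cases i with
    | zero =>
      rw [← Submodule.finrank_map_add_finrank_ker_inf _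
        (ρ.aug.restrictScalars (MvPolynomial (Fin n) ℂ)), map_aug_freeSubmodule,
        ← map_diff_zero_freeSubmodule, Nat.cast_add]
      rfl
    | succ i =>
      rw [← Submodule.finrank_map_add_finrank_ker_inf _
        ((ρ.diff i).restrictScalars (MvPolynomial (Fin n) ℂ)), ← map_diff_succ_freeSubmodule,
        Nat.cast_add]
  · have h : (freeSubmodule (ρ.shift (ρ.length + 1)) d :
        Submodule (MvPolynomial (Fin n) ℂ) _) = ⊥ := by
      have := ρ.rank_eq_zero (ρ.length + 1) (Nat.lt_succ_self _)
      have : IsEmpty (Fin (ρ.rank (ρ.length + 1))) := by rw [this]; infer_instance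
      exact Subsingleton.elim _ _
    show (Module.finrank _ (Submodule.map _ _) : ℤ) = 0
    rw [h, Submodule.map_bot, finrank_bot, Nat.cast_zero]

theorem hilbertValue_kPolynomial_le {F' : FFiltration n M} (ρ : FilteredFreeResolution F)
    (ρ' : FilteredFreeResolution F') {d e : ℤ} (h : F.level d ≤ F'.level e) :
    hilbertValue n d ρ.kPolynomial ≤ hilbertValue n e ρ'.kPolynomial := by
  rw [← ρ.finrank_levelSubmodule, ← ρ'.finrank_levelSubmodule]
  have := ρ'.finite_levelSubmodule e
  exact_mod_cast Submodule.finrank_mono (show F.levelSubmodule d ≤ F'.levelSubmodule e from h)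

theorem hilbertValue_kPolynomial_nonneg (ρ : FilteredFreeResolution F) (d : ℤ) :
    0 ≤ hilbertValue n d ρ.kPolynomial := by
  rw [← ρ.finrank_levelSubmodule]
  exact Nat.cast_nonneg _

theorem monotone_hilbertValue_kPolynomial (ρ : FilteredFreeResolution F) :
    Monotone fun d => hilbertValue n d ρ.kPolynomial :=
  fun _ _ h => ρ.hilbertValue_kPolynomial_le ρ (F.mono h)

theorem kPolynomial_eq (ρ ρ' : FilteredFreeResolution F) : ρ.kPolynomial = ρ'.kPolynomial := by
  rw [← sub_eq_zero]
  refine eq_zero_of_hilbertValue_eq_zero n fun d => ?_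
  rw [map_sub, ← ρ.finrank_levelSubmodule, ← ρ'.finrank_levelSubmodule, sub_self]

theorem exists_multidegree_eq (ρ : FilteredFreeResolution F) :
    ∃ m c : ℕ, ∀ (F' : FFiltration n M) (ρ' : FilteredFreeResolution F'),
      ρ'.multidegree = Polynomial.C (m : ℤ) * Polynomial.X ^ c := by
  obtain ⟨m, c, h⟩ := leastTerm_eq_of_hilbertValue_le ρ.hilbertValue_kPolynomial_nonneg
    ρ.monotone_hilbertValue_kPolynomial
  refine ⟨m, c, fun F' ρ' => h _ ρ'.hilbertValue_kPolynomial_nonneg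
    ρ'.monotone_hilbertValue_kPolynomial ?_ ?_⟩
  · obtain ⟨N, hN⟩ := ρ.exists_level_le F'
    exact ⟨N, fun d => ρ.hilbertValue_kPolynomial_le ρ' (hN d)⟩
  · obtain ⟨N, hN⟩ := ρ'.exists_level_le F
    exact ⟨N, fun d => ρ'.hilbertValue_kPolynomial_le ρ (hN d)⟩

end FilteredFreeResolution

end

theorem proposition5 (n : ℕ) {M : Type*} [AddCommGroup M] [Module (WeylAlgebra n) M] :
    (∀ (F : FFiltration n M) (ρ ρ' : FilteredFreeResolution F),
      ρ.kPolynomial = ρ'.kPolynomial) ∧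
    (∃ m d : ℕ, ∀ F : FFiltration n M, F.IsGood → ∀ ρ : FilteredFreeResolution F,
      ρ.multidegree = Polynomial.C (m : ℤ) * Polynomial.X ^ d) := by
  -- Restriction of scalars along `ℂ[x] → D` supplies the structure in which the ranks are taken.
  let : Module (MvPolynomial (Fin n) ℂ) M := Module.compHom M (ofPoly n).toRingHom
  have : IsScalarTower (MvPolynomial (Fin n) ℂ) (WeylAlgebra n) M :=
    ⟨fun p P m => mul_smul (ofPoly n p) P m⟩
  refine ⟨fun F ρ ρ' => ρ.kPolynomial_eq ρ', ?_⟩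
  -- Any single filtration with a resolution serves as the reference that fixes `m` and `d`. If
  -- there is none, the claim is vacuous and the values `0, 0` are arbitrary.
  by_cases h : ∃ F : FFiltration n M, Nonempty (FilteredFreeResolution F)
  · obtain ⟨F, ⟨ρ⟩⟩ := h
    obtain ⟨m, c, hmc⟩ := ρ.exists_multidegree_eq
    exact ⟨m, c, fun F' _ ρ' => hmc F' ρ'⟩
  · exact ⟨0, 0, fun F _ ρ => absurd ⟨F, ⟨ρ⟩⟩ h⟩
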